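/- Let $n\ge 0$ be an integer and let $K\subset\mathbb{R}^{n+1}$ be a smooth, strictly convex body with the origin in its interior. That is, $K$ is compact and convex, its support function $h(x)=\max_{y\in K}\langle x,y\rangle$ is smooth on the unit sphere $\mathbb{S}^n$, and $\bar\nabla^2h+\bar g\,h$ is positive definite at every point of $\mathbb{S}^n$, where $\bar g$ is the round metric of $\mathbb{S}^n$ and $\bar\nabla$ its Levi-Civita connection. Let $\theta$ be the spherical Lebesgue measure on $\mathbb{S}^n$, let the Gauss curvature $\mathcal{K}$ of $K$, as a function of the outward unit normal $x\in\mathbb{S}^n$, be given by \[ \frac{1}{\mathcal{K}}=\frac{\det(\bar\nabla^2h+\bar g\,h)}{\det\bar g}, \] and let $dV=\frac{h}{\mathcal{K}}\,d\theta$ (so that $\frac1{n+1}V$ is the cone-volume measure of $K$). Let $p\in\mathbb{R}$ with $p\ne-(n+1)$. If $dV=h^p\,d\theta$ (equivalently, $\mathcal{K}=h^{1-p}$ on $\mathbb{S}^n$), then $x\otimes x$ is $V$-integrable and \[ \int_{\mathbb{S}^n}x\otimes x\,dV(x)=\Big(\frac{1}{n+1}\int_{\mathbb{S}^n}dV\Big)\mathrm{Id},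 \] where $x\otimes x$ denotes the linear map $w\mapsto\langle x,w\rangle x$ of $\mathbb{R}^{n+1}$. -/

import Mathlib

open MeasureTheory
open scoped ContDiff InnerProductSpace

noncomputable section

namespace ConvexBodyGeometry

section Definitions

variable {E : Type*} [NormedAddCommGroup E] [InnerProductSpace ℝ E]

/-- The support function `h_K(x) = max {⟪x, y⟫ : y ∈ K}`, as a function on the whole space (the
`1`-homogeneous extension of its restriction to the unit sphere). -/
def supportFunction (K : Set E) (x : E) : ℝ :=
  sSup ((fun y => ⟪x, y⟫_ℝ) '' K)

/-- The extension of `f` restricted to the unit sphere which is constant on open rays. -/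
def radialExtension (f : E → ℝ) (y : E) : ℝ :=
  f (‖y‖⁻¹ • y)

/-- The tangent space `x^⊥` of the unit sphere at the unit vector `x`. -/
abbrev tangent (x : E) : Submodule ℝ E := (ℝ ∙ x)ᗮ

/-- The Hessian `∇̄² f (u, v)` at the unit vector `x`, for the Levi-Civita connection of the round
unit sphere, of the restriction of `f` to the sphere. For tangent vectors `u, v` it is the Euclidean
Hessian at `x` of the radially constant extension: the two differ by the derivative of the extension
in the direction of the second fundamental form `-⟪u, v⟫ x`, which is zero as `x` is radial. -/
def sphereHessian (f : E → ℝ) (x : E) (u v : tangent x) : ℝ :=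
  fderiv ℝ (fderiv ℝ (radialExtension f)) x (u : E) (v : E)

/-- The symmetric bilinear form `∇̄² h_K + h_K ḡ` on the tangent space of the sphere at `x`. -/
def curvatureForm (K : Set E) (x : E) (u v : tangent x) : ℝ :=
  sphereHessian (supportFunction K) x u v + supportFunction K x * ⟪u, v⟫_ℝ

/-- A smooth, strictly convex body: a compact convex set with non-empty interior whose support
function is smooth away from the origin (equivalently, smooth on the unit sphere) and has
`∇̄² h_K + h_K ḡ` positive definite, that is, all principal radii of curvature are positive. -/
structure IsSmoothStrictlyConvexBody (K : Set E) : Prop where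
  isCompact : IsCompact K
  convex : Convex ℝ K
  nonempty_interior : (interior K).Nonempty
  smooth : ContDiffOn ℝ ∞ (supportFunction K) {0}ᶜ
  posDef : ∀ x : E, ‖x‖ = 1 → ∀ u : tangent x, u ≠ 0 → 0 < curvatureForm K x u u

variable [FiniteDimensional ℝ E]

/-- The Gauss curvature of `K` at the boundary point with outward unit normal `x`, given by
`1 / 𝒦 = det (∇̄² h_K + h_K ḡ) / det ḡ`. The determinants are taken in an orthonormal basis of the
tangent space, so that `det ḡ = 1`; the quotient does not depend on the basis. -/
def gaussCurvature (K : Set E) (x : E) : ℝ :=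
  let b := stdOrthonormalBasis ℝ (tangent x)
  ((Matrix.of fun i j => curvatureForm K x (b i) (b j)).det)⁻¹

variable [MeasurableSpace E] [BorelSpace E]

variable (E) in
/-- The spherical Lebesgue measure `θ` on the unit sphere. -/
def sphereMeasure : Measure (Metric.sphere (0 : E) 1) :=
  (volume : Measure E).toSphere

/-- The measure `dV_K = (h_K / 𝒦_K) dθ` on the unit sphere, which is `dim E` times the cone-volume
measure of `K`. -/
def weightedConeMeasure (K : Set E) : Measure (Metric.sphere (0 : E) 1) :=
  (sphereMeasure E).withDensity fun x =>
    ENNReal.ofReal (supportFunction K x / gaussCurvature K x)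

end Definitions

end ConvexBodyGeometry

end

/-! For a `C¹` vector field `W`, positively homogeneous of degree `q` away from the origin of a
`d`-dimensional space, the divergence theorem on the sphere reads
`∫ div W dθ = (d - 1 + q) ∫ ⟪x, W⟫ dθ`. Two fields give the result.

The map `Ψ x = ‖x‖ ∇h(x)` is homogeneous of degree one, and at a unit vector `x` its derivative is
`∇̄²h + ḡ h` on `x^⊥` and `h` on the normal line, so `det DΨ = h / 𝒦`. By Piola's identity the field
`det DΨ · (DΨ)⁻¹ A Ψ` has divergence `tr A · h / 𝒦`, while its radial component is `𝒦⁻¹ ⟪x, A ∇h⟫`;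
hence `d ∫ 𝒦⁻¹ ⟪x, A ∇h⟫ dθ = tr A ∫ h / 𝒦 dθ`. The field `h ^ p B x`, of degree `p + 1`, gives
`(d + p) ∫ h ^ p ⟪x, B x⟫ dθ = p ∫ h ^ (p - 1) ⟪B x, ∇h⟫ dθ + tr B ∫ h ^ p dθ`.

When `𝒦⁻¹ = h ^ (p - 1)`, choosing `A = Bᵀ` makes the two middle integrals equal, and eliminating
them leaves `d (d + p) ∫ ⟪x, B x⟫ dV = (d + p) tr B ∫ dV`, where `d + p` cancels. -/

namespace ConvexBodyGeometry

open Module Set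

section IsPosHomogeneous

section Module

variable {E F G : Type*} [AddCommGroup E] [Module ℝ E] [AddCommGroup F] [Module ℝ F]

/-- Positive homogeneity of real degree `q` of a map defined away from the origin: the value at the
origin is unconstrained, so that derivatives of homogeneous maps are homogeneous. -/
def IsPosHomogeneous (f : E → F) (q : ℝ) : Prop :=
  ∀ ⦃t : ℝ⦄, 0 < t → ∀ ⦃x : E⦄, x ≠ 0 → f (t • x) = t ^ q • f x

theorem isPosHomogeneous_one_iff {f : E → F} :
    IsPosHomogeneous f 1 ↔ ∀ ⦃t : ℝ⦄, 0 < t → ∀ ⦃x : E⦄, x ≠ 0 → f (t • x) = t • f x := by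
  simp only [IsPosHomogeneous, Real.rpow_one]

theorem isPosHomogeneous_zero_iff {f : E → F} :
    IsPosHomogeneous f 0 ↔ ∀ ⦃t : ℝ⦄, 0 < t → ∀ ⦃x : E⦄, x ≠ 0 → f (t • x) = f x := by
  simp only [IsPosHomogeneous, Real.rpow_zero, one_smul]

theorem isPosHomogeneous_id : IsPosHomogeneous (fun x : E => x) 1 :=
  isPosHomogeneous_one_iff.2 fun _ _ _ _ => rfl

namespace IsPosHomogeneous

variable {f : E → F} {g : E → ℝ} {p q : ℝ}

protected theorem map [AddCommGroup G] [Module ℝ G] {Φ : Type*} [FunLike Φ F G]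
    [LinearMapClass Φ ℝ F G] (A : Φ) (hf : IsPosHomogeneous f q) :
    IsPosHomogeneous (fun x => A (f x)) q := fun t ht x hx => by
  simp only [hf ht hx, map_smul]

protected theorem smul (hg : IsPosHomogeneous g p) (hf : IsPosHomogeneous f q) :
    IsPosHomogeneous (fun x => g x • f x) (p + q) := fun t ht x hx => by
  simp only [hg ht hx, hf ht hx, Real.rpow_add ht, smul_eq_mul, smul_smul]
  rw [mul_right_comm]

protected theorem rpow (hg : IsPosHomogeneous g p) (hg0 : ∀ x, x ≠ 0 → 0 ≤ g x) (q : ℝ) :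
    IsPosHomogeneous (fun x => g x ^ q) (p * q) := fun t ht x hx => by
  simp only [hg ht hx, smul_eq_mul, Real.mul_rpow (Real.rpow_nonneg ht.le p) (hg0 x hx),
    Real.rpow_mul ht.le]

end IsPosHomogeneous

end Module

theorem isPosHomogeneous_norm {E : Type*} [NormedAddCommGroup E] [NormedSpace ℝ E] :
    IsPosHomogeneous (fun x : E => ‖x‖) 1 :=
  isPosHomogeneous_one_iff.2 fun _ ht _ _ => norm_smul_of_nonneg ht.le _

protected theorem IsPosHomogeneous.inner {E F : Type*} [AddCommGroup E] [Module ℝ E]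
    [NormedAddCommGroup F] [InnerProductSpace ℝ F] {f g : E → F} {p q : ℝ}
    (hf : IsPosHomogeneous f p) (hg : IsPosHomogeneous g q) :
    IsPosHomogeneous (fun x => ⟪f x, g x⟫_ℝ) (p + q) := fun t ht x hx => by
  simp only [hf ht hx, hg ht hx, real_inner_smul_left, real_inner_smul_right, Real.rpow_add ht,
    smul_eq_mul, mul_assoc]
  rw [mul_left_comm]

namespace IsPosHomogeneous

variable {E F : Type*} [NormedAddCommGroup E] [NormedSpace ℝ E] [NormedAddCommGroup F]
  [NormedSpace ℝ F] {f : E → F} {q : ℝ} {x : E}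

protected theorem fderiv (hf : IsPosHomogeneous f q) : IsPosHomogeneous (fderiv ℝ f) (q - 1) := by
  intro t ht x hx
  have hft : (fun y => f (t • y)) =ᶠ[nhds x] t ^ q • f := by
    filter_upwards [isOpen_compl_singleton.mem_nhds hx] with y hy using hf ht hy
  have hscale : t • fderiv ℝ f (t • x) = t ^ q • fderiv ℝ f x := by
    rw [← fderiv_comp_smul, hft.fderiv_eq, fderiv_const_smul_field, Pi.smul_apply]
  rw [← inv_smul_smul₀ ht.ne' (fderiv ℝ f (t • x)), hscale, smul_smul,
    Real.rpow_sub_one ht.ne', div_eq_inv_mul]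

theorem fderiv_apply_self (hf : IsPosHomogeneous f q) (hx : x ≠ 0)
    (hfx : DifferentiableAt ℝ f x) : fderiv ℝ f x x = q • f x := by
  have hray : HasDerivAt (fun t : ℝ => t • x) x 1 := by
    simpa using (hasDerivAt_id (1 : ℝ)).smul_const x
  have hpow : HasDerivAt (fun t : ℝ => t ^ q • f x) (q • f x) 1 := by
    simpa using (Real.hasDerivAt_rpow_const (x := 1) (p := q) (Or.inl one_ne_zero)).smul_const (f x)
  have hfx' : HasFDerivAt f (fderiv ℝ f x) ((1 : ℝ) • x) := by
    simpa using hfx.hasFDerivAt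
  refine (hfx'.comp_hasDerivAt (1 : ℝ) hray).unique (hpow.congr_of_eventuallyEq ?_)
  filter_upwards [Ioi_mem_nhds (zero_lt_one (α := ℝ))] with t ht using hf ht hx

end IsPosHomogeneous

end IsPosHomogeneous

section Divergence

variable {E : Type*} [NormedAddCommGroup E] [NormedSpace ℝ E]

/-- The divergence of a vector field, as the trace of its derivative. -/
noncomputable def divergence (Y : E → E) (x : E) : ℝ :=
  LinearMap.trace ℝ E (fderiv ℝ Y x)

theorem divergence_clm (A : E →L[ℝ] E) (x : E) : divergence A x = LinearMap.trace ℝ E A := by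
  rw [divergence, A.fderiv]

protected theorem IsPosHomogeneous.divergence {Y : E → E} {q : ℝ} (hY : IsPosHomogeneous Y q) :
    IsPosHomogeneous (divergence Y) (q - 1) :=
  hY.fderiv.map ((LinearMap.trace ℝ E).comp (ContinuousLinearMap.coeLM ℝ))

variable [FiniteDimensional ℝ E]

theorem divergence_smul {f : E → ℝ} {Y : E → E} {x : E} (hf : DifferentiableAt ℝ f x)
    (hY : DifferentiableAt ℝ Y x) :
    divergence (fun y => f y • Y y) x = f x * divergence Y x + fderiv ℝ f x (Y x) := by
  have hcoe : ((fderiv ℝ f x).smulRight (Y x) : E →ₗ[ℝ] E) =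
      (fderiv ℝ f x : E →ₗ[ℝ] ℝ).smulRight (Y x) := rfl
  rw [divergence, fderiv_fun_smul hf hY, ContinuousLinearMap.toLinearMap_add,
    ContinuousLinearMap.toLinearMap_smul, map_add, map_smul, hcoe, LinearMap.trace_smulRight]
  rfl

theorem continuousOn_divergence {Y : E → E} {s : Set E} (hs : IsOpen s) (hY : ContDiffOn ℝ 1 Y s) :
    ContinuousOn (divergence Y) s :=
  ((LinearMap.trace ℝ E).comp
    (ContinuousLinearMap.coeLM ℝ)).continuous_of_finiteDimensional.comp_continuousOn
      (hY.continuousOn_fderiv_of_isOpen hs le_rfl)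

variable [MeasurableSpace E] [BorelSpace E] (μ : Measure E) [μ.IsAddHaarMeasure]

theorem integral_fderiv_apply_eq_zero {f : E → ℝ} (hf : ContDiff ℝ 1 f)
    (hfc : HasCompactSupport f) (v : E) : ∫ x, fderiv ℝ f x v ∂μ = 0 := by
  have hf' : Integrable (fun x => fderiv ℝ f x v) μ :=
    ((hf.continuous_fderiv one_ne_zero).clm_apply continuous_const).integrable_of_hasCompactSupport
      (hfc.fderiv_apply (𝕜 := ℝ) v)
  simpa using integral_mul_fderiv_eq_neg_fderiv_mul_of_integrable (μ := μ)
    (f := fun _ => (1 : ℝ)) (g := f) (v := v) (by simp) (by simpa using hf')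
    (by simpa using hf.continuous.integrable_of_hasCompactSupport hfc)
    (fun _ _ => differentiableAt_const _) (fun x _ => hf.differentiable one_ne_zero x)

theorem integral_divergence_eq_zero {Z : E → E} (hZ : ContDiff ℝ 1 Z)
    (hZc : HasCompactSupport Z) : ∫ x, divergence Z x ∂μ = 0 := by
  let b := finBasis ℝ E
  let coord (i : Fin (finrank ℝ E)) : E →L[ℝ] ℝ := (b.coord i).toContinuousLinearMap
  have hdiv (x : E) : divergence Z x = ∑ i, fderiv ℝ (fun y => coord i (Z y)) x (b i) := by
    have hcoord (i) : HasFDerivAt (fun y => coord i (Z y)) ((coord i).comp (fderiv ℝ Z x)) x :=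
      (coord i).hasFDerivAt.comp x (hZ.differentiable one_ne_zero x).hasFDerivAt
    rw [divergence, LinearMap.trace_eq_matrix_trace ℝ b, Matrix.trace]
    refine Finset.sum_congr rfl fun i _ => ?_
    rw [(hcoord i).fderiv, Matrix.diag_apply, LinearMap.toMatrix_apply]
    rfl
  have hC1 (i) : ContDiff ℝ 1 fun y => coord i (Z y) := (coord i).contDiff.comp hZ
  have hcs (i) : HasCompactSupport fun y => coord i (Z y) := hZc.comp_left (map_zero (coord i))
  simp_rw [hdiv]
  rw [integral_finsetSum]
  · exact Finset.sum_eq_zero fun i _ => integral_fderiv_apply_eq_zero μ (hC1 i) (hcs i) (b i)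
  · exact fun i _ => (((hC1 i).continuous_fderiv one_ne_zero).clm_apply
      continuous_const).integrable_of_hasCompactSupport ((hcs i).fderiv_apply (𝕜 := ℝ) _)

end Divergence

section RadialCutoff

theorem contDiff_comp_norm_smul {E F : Type*} [NormedAddCommGroup E] [InnerProductSpace ℝ E]
    [NormedAddCommGroup F] [NormedSpace ℝ F] {n : ℕ∞ω} {χ : ℝ → ℝ} (hχ : ContDiff ℝ n χ)
    (h0 : 0 ∉ tsupport χ) {G : E → F} (hG : ContDiffOn ℝ n G {0}ᶜ) :
    ContDiff ℝ n fun x => χ ‖x‖ • G x := by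
  refine contDiff_iff_contDiffAt.2 fun x => ?_
  rcases eq_or_ne x 0 with rfl | hx
  · have hχ0 : ∀ᶠ y : E in nhds 0, χ ‖y‖ = 0 :=
      (continuous_norm.tendsto' (0 : E) 0 norm_zero).eventually
        (notMem_tsupport_iff_eventuallyEq.1 h0)
    refine (contDiffAt_const (c := (0 : F))).congr_of_eventuallyEq ?_
    filter_upwards [hχ0] with y hy
    rw [hy, zero_smul]
  · exact (hχ.contDiffAt.comp x (contDiffAt_norm ℝ hx)).smul
      (hG.contDiffAt (isOpen_compl_singleton.mem_nhds hx))

theorem hasCompactSupport_comp_norm_smul {E F : Type*} [NormedAddCommGroup E] [ProperSpace E]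
    [AddCommGroup F] [Module ℝ F] {χ : ℝ → ℝ} (hχ : HasCompactSupport χ) (G : E → F) :
    HasCompactSupport fun x => χ ‖x‖ • G x := by
  obtain ⟨R, hR⟩ := hχ.isCompact.isBounded.subset_closedBall 0
  refine HasCompactSupport.intro (isCompact_closedBall (0 : E) R) fun x hx => ?_
  have hχx : χ ‖x‖ = 0 := image_eq_zero_of_notMem_tsupport fun hmem => hx (by simpa using hR hmem)
  rw [hχx, zero_smul]

theorem integrable_comp_norm_smul {E F : Type*} [NormedAddCommGroup E] [InnerProductSpace ℝ E]
    [FiniteDimensional ℝ E] [MeasurableSpace E] [BorelSpace E] {μ : Measure E}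
    [IsFiniteMeasureOnCompacts μ] [NormedAddCommGroup F] [NormedSpace ℝ F] {χ : ℝ → ℝ}
    (hχ : Continuous χ) (hχc : HasCompactSupport χ) (h0 : 0 ∉ tsupport χ) {G : E → F}
    (hG : ContinuousOn G {0}ᶜ) : Integrable (fun x => χ ‖x‖ • G x) μ :=
  (contDiff_zero.1 (contDiff_comp_norm_smul (contDiff_zero.2 hχ) h0
    (contDiffOn_zero.2 hG))).integrable_of_hasCompactSupport
      (hasCompactSupport_comp_norm_smul hχc G)

theorem integrableOn_Ioi_rpow_mul (s : ℝ) {χ : ℝ → ℝ} (hχ : Continuous χ)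
    (hχc : HasCompactSupport χ) (h0 : 0 ∉ tsupport χ) :
    IntegrableOn (fun t => t ^ s * χ t) (Ioi 0) := by
  have hint : Integrable fun t : ℝ => χ ‖t‖ • t ^ s := integrable_comp_norm_smul hχ hχc h0
    (continuousOn_id.rpow_const fun _ ht => Or.inl ht)
  refine hint.integrableOn.congr_fun (fun t (ht : 0 < t) => ?_) measurableSet_Ioi
  simp only [Real.norm_of_nonneg ht.le, smul_eq_mul, mul_comm]

theorem integral_Ioi_rpow_mul_deriv (s : ℝ) {χ : ℝ → ℝ} (hχ : ContDiff ℝ 1 χ)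
    (hχc : HasCompactSupport χ) (h0 : 0 ∉ tsupport χ) :
    ∫ t in Ioi (0 : ℝ), t ^ s * deriv χ t = -s * ∫ t in Ioi (0 : ℝ), t ^ (s - 1) * χ t := by
  have hrpow : ContDiffOn ℝ 1 (fun t : ℝ => t ^ s) {0}ᶜ := fun t ht =>
    (Real.contDiffAt_rpow_const_of_ne ht).contDiffWithinAt
  have hzero : ∫ t in Ioi (0 : ℝ), deriv (fun t => χ ‖t‖ • t ^ s) t = 0 := by
    rw [(hasCompactSupport_comp_norm_smul hχc _).integral_Ioi_deriv_eq
      (contDiff_comp_norm_smul hχ h0 hrpow), norm_zero, image_eq_zero_of_notMem_tsupport h0,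
      zero_smul, neg_zero]
  have hderiv : EqOn (deriv fun t => χ ‖t‖ • t ^ s)
      (fun t => t ^ s * deriv χ t + s * (t ^ (s - 1) * χ t)) (Ioi 0) := by
    intro t (ht : 0 < t)
    have hnorm : (fun r => χ ‖r‖ • r ^ s) =ᶠ[nhds t] fun r => χ r * r ^ s := by
      filter_upwards [Ioi_mem_nhds ht] with r hr
      rw [Real.norm_of_nonneg (le_of_lt hr), smul_eq_mul]
    rw [hnorm.deriv_eq, ((hχ.differentiable one_ne_zero t).hasDerivAt.fun_mul
      (Real.hasDerivAt_rpow_const (Or.inl ht.ne'))).deriv]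
    ring
  rw [setIntegral_congr_fun measurableSet_Ioi hderiv, integral_add
    (integrableOn_Ioi_rpow_mul s (hχ.continuous_deriv le_rfl) hχc.deriv
      fun h => h0 (tsupport_deriv_subset h))
    ((integrableOn_Ioi_rpow_mul (s - 1) hχ.continuous hχc h0).const_mul s),
    integral_const_mul] at hzero
  linarith

theorem exists_contDiff_integral_rpow_mul_pos (s : ℝ) : ∃ χ : ℝ → ℝ, ContDiff ℝ 1 χ ∧
    HasCompactSupport χ ∧ 0 ∉ tsupport χ ∧ 0 < ∫ t in Ioi (0 : ℝ), t ^ s * χ t := by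
  let χ : ContDiffBump (2 : ℝ) := ⟨1 / 2, 1, by norm_num, by norm_num⟩
  have h0 : (0 : ℝ) ∉ tsupport χ := by
    rw [χ.tsupport_eq, Real.closedBall_eq_Icc]
    norm_num [χ]
  refine ⟨χ, χ.contDiff, χ.hasCompactSupport, h0, ?_⟩
  have hsupport : Ioo 1 3 ⊆ (Function.support fun t : ℝ => t ^ s * χ t) ∩ Ioi 0 := by
    intro t ht
    have ht0 : 0 < t := one_pos.trans ht.1
    have hχt : t ∈ Function.support χ := by
      rw [χ.support_eq, Real.ball_eq_Ioo]
      exact ⟨by linarith [ht.1], by linarith [ht.2]⟩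
    exact ⟨mul_ne_zero (Real.rpow_pos_of_pos ht0 s).ne' hχt, ht0⟩
  rw [setIntegral_pos_iff_support_of_nonneg_ae]
  · exact (by simp : 0 < volume (Ioo (1 : ℝ) 3)).trans_le (measure_mono hsupport)
  · filter_upwards [self_mem_ae_restrict measurableSet_Ioi] with t ht
    exact mul_nonneg (Real.rpow_nonneg (le_of_lt ht) s) χ.nonneg
  · exact integrableOn_Ioi_rpow_mul s χ.continuous χ.hasCompactSupport h0

end RadialCutoff

section SphereDivergence

theorem IsPosHomogeneous.integral_comp_norm_smul {E F : Type*} [NormedAddCommGroup E]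
    [NormedSpace ℝ E] [FiniteDimensional ℝ E] [Nontrivial E] [MeasurableSpace E] [BorelSpace E]
    [NormedAddCommGroup F] [NormedSpace ℝ F] (μ : Measure E) [μ.IsAddHaarMeasure] (a : ℝ → ℝ)
    {b : E → F} {q : ℝ} (hb : IsPosHomogeneous b q) :
    ∫ x, a ‖x‖ • b x ∂μ = (∫ t in Ioi (0 : ℝ), t ^ (finrank ℝ E - 1 + q) * a t) •
      ∫ x : Metric.sphere (0 : E) 1, b x ∂μ.toSphere := by
  have hdim : ((finrank ℝ E - 1 : ℕ) : ℝ) = finrank ℝ E - 1 := by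
    rw [Nat.cast_sub finrank_pos, Nat.cast_one]
  calc ∫ x, a ‖x‖ • b x ∂μ
      = ∫ x : ({0}ᶜ : Set E), a ‖(x : E)‖ • b x ∂μ.comap (↑) := by
        rw [integral_subtype_comap (measurableSet_singleton (0 : E)).compl fun x => a ‖x‖ • b x,
          restrict_compl_singleton]
    _ = ∫ z : Metric.sphere (0 : E) 1 × Ioi (0 : ℝ), (a z.2 * (z.2 : ℝ) ^ q) • b z.1
          ∂μ.toSphere.prod (.volumeIoiPow (finrank ℝ E - 1)) := by
        rw [← μ.measurePreserving_homeomorphUnitSphereProd.integral_comp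
          (Homeomorph.measurableEmbedding _)]
        refine integral_congr_ae (.of_forall fun x => ?_)
        have hx : 0 < ‖(x : E)‖ := norm_pos_iff.2 x.2
        have hbx := hb hx (x := ‖(x : E)‖⁻¹ • (x : E)) (smul_ne_zero (inv_ne_zero hx.ne') x.2)
        rw [smul_inv_smul₀ hx.ne'] at hbx
        simp only [homeomorphUnitSphereProd_apply_snd_coe,
          homeomorphUnitSphereProd_apply_fst_coe, hbx, mul_smul]
    _ = (∫ t : Ioi (0 : ℝ), a t * (t : ℝ) ^ q ∂.volumeIoiPow (finrank ℝ E - 1)) •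
          ∫ x : Metric.sphere (0 : E) 1, b x ∂μ.toSphere := by
        rw [← integral_prod_swap]
        exact integral_prod_smul (fun t : Ioi (0 : ℝ) => a t * (t : ℝ) ^ q)
          fun x : Metric.sphere (0 : E) 1 => b x
    _ = _ := by
        congr 1
        simp only [Measure.volumeIoiPow, ENNReal.ofReal]
        rw [integral_withDensity_eq_integral_smul (by fun_prop),
          integral_subtype_comap measurableSet_Ioi
            fun t => Real.toNNReal (t ^ (finrank ℝ E - 1)) • (a t * t ^ q)]
        refine setIntegral_congr_fun measurableSet_Ioi fun t (ht : 0 < t) => ?_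
        simp only [NNReal.smul_def, Real.coe_toNNReal _ (pow_nonneg ht.le _), smul_eq_mul]
        rw [← hdim, Real.rpow_add ht, Real.rpow_natCast]
        ring

variable {E : Type*} [NormedAddCommGroup E] [InnerProductSpace ℝ E]

theorem hasFDerivAt_norm {x : E} (hx : x ≠ 0) :
    HasFDerivAt (fun y : E => ‖y‖) (‖x‖⁻¹ • innerSL ℝ x) x := by
  have hsqrt := (hasStrictFDerivAt_norm_sq x).hasFDerivAt.sqrt (by simpa using hx)
  simp only [Real.sqrt_sq (norm_nonneg _)] at hsqrt
  exact hsqrt.congr_fderiv (by ext v; simp [field])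

variable [FiniteDimensional ℝ E]

theorem divergence_comp_norm_smul {χ : ℝ → ℝ} {W : E → E} {x : E} (hx : x ≠ 0)
    (hχ : DifferentiableAt ℝ χ ‖x‖) (hW : DifferentiableAt ℝ W x) :
    divergence (fun y => χ ‖y‖ • W y) x =
      deriv χ ‖x‖ * (‖x‖⁻¹ * ⟪x, W x⟫_ℝ) + χ ‖x‖ * divergence W x := by
  have hχ' : HasFDerivAt (fun y : E => χ ‖y‖) (deriv χ ‖x‖ • ‖x‖⁻¹ • innerSL ℝ x) x :=
    hχ.hasDerivAt.comp_hasFDerivAt x (hasFDerivAt_norm hx)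
  rw [divergence_smul hχ'.differentiableAt hW, hχ'.fderiv, add_comm]
  rfl

variable [Nontrivial E] [MeasurableSpace E] [BorelSpace E] (μ : Measure E) [μ.IsAddHaarMeasure]

/-- Integrate the divergence of `χ(‖x‖) W` in polar coordinates, for a radial cutoff `χ`. -/
theorem integral_sphere_divergence {W : E → E} {q : ℝ} (hW : ContDiffOn ℝ 1 W {0}ᶜ)
    (hWq : IsPosHomogeneous W q) :
    ∫ x : Metric.sphere (0 : E) 1, divergence W x ∂μ.toSphere =
      (finrank ℝ E - 1 + q) * ∫ x : Metric.sphere (0 : E) 1, ⟪(x : E), W x⟫_ℝ ∂μ.toSphere := by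
  obtain ⟨χ, hχ, hχc, h0, hpos⟩ :=
    exists_contDiff_integral_rpow_mul_pos (finrank ℝ E - 1 + q - 1)
  have hradial : IsPosHomogeneous (fun x : E => ‖x‖⁻¹ * ⟪x, W x⟫_ℝ) q := by
    have hinv := isPosHomogeneous_norm.rpow (fun x : E => fun _ => norm_nonneg x) (-1)
    simpa [Real.rpow_neg_one] using hinv.smul (isPosHomogeneous_id.inner hWq)
  have hradial_int : Integrable (fun x => deriv χ ‖x‖ • (‖x‖⁻¹ * ⟪x, W x⟫_ℝ)) μ :=
    integrable_comp_norm_smul (hχ.continuous_deriv le_rfl) hχc.deriv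
      (fun h => h0 (tsupport_deriv_subset h))
      ((continuousOn_id.norm.inv₀ fun x hx => norm_ne_zero_iff.2 hx).mul
        (continuousOn_id.inner hW.continuousOn))
  have hdiv_int : Integrable (fun x => χ ‖x‖ • divergence W x) μ :=
    integrable_comp_norm_smul hχ.continuous hχc h0
      (continuousOn_divergence isOpen_compl_singleton hW)
  have hdecomp : ∀ᵐ x ∂μ, divergence (fun y => χ ‖y‖ • W y) x =
      deriv χ ‖x‖ • (‖x‖⁻¹ * ⟪x, W x⟫_ℝ) + χ ‖x‖ • divergence W x := by
    filter_upwards [compl_mem_ae_iff.2 (measure_singleton (0 : E))] with x hx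
    exact divergence_comp_norm_smul hx (hχ.differentiable one_ne_zero _)
      (hW.differentiableOn one_ne_zero |>.differentiableAt (isOpen_compl_singleton.mem_nhds hx))
  have hzero := integral_divergence_eq_zero μ (contDiff_comp_norm_smul hχ h0 hW)
    (hasCompactSupport_comp_norm_smul hχc W)
  rw [integral_congr_ae hdecomp, integral_add hradial_int hdiv_int,
    hradial.integral_comp_norm_smul μ, hWq.divergence.integral_comp_norm_smul μ,
    integral_Ioi_rpow_mul_deriv _ hχ hχc h0, ← add_sub_assoc] at hzero
  simp only [norm_eq_of_mem_sphere, inv_one, one_mul, smul_eq_mul] at hzero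
  refine mul_left_cancel₀ hpos.ne' ?_
  linear_combination hzero

end SphereDivergence

section Piola

theorem hasFDerivAt_ringInverse_clm_apply {E F : Type*} [NormedAddCommGroup E] [NormedSpace ℝ E]
    [NormedAddCommGroup F] [NormedSpace ℝ F] [CompleteSpace F] {L : E → F →L[ℝ] F}
    {L' : E →L[ℝ] F →L[ℝ] F} {a : E → F} {a' : E →L[ℝ] F} {x : E} (hL : HasFDerivAt L L' x)
    (ha : HasFDerivAt a a' x) (hLx : IsUnit (L x)) :
    HasFDerivAt (fun y => Ring.inverse (L y) (a y))
      ((Ring.inverse (L x)).comp (a' - L'.flip (Ring.inverse (L x) (a x)))) x := by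
  have hinv : HasFDerivAt (fun y => Ring.inverse (L y))
      ((-ContinuousLinearMap.mulLeftRight ℝ (F →L[ℝ] F) (Ring.inverse (L x))
        (Ring.inverse (L x))).comp L') x := by
    obtain ⟨u, hu⟩ := hLx
    have hu' := hasFDerivAt_ringInverse (𝕜 := ℝ) u
    rw [← Ring.inverse_unit, hu] at hu'
    exact hu'.comp x hL
  refine (hinv.clm_apply ha).congr_fderiv ?_
  ext v
  simp [sub_eq_add_neg]

variable {E : Type*} [NormedAddCommGroup E] [NormedSpace ℝ E]

/-- The image of the linear field `A`, read in the coordinates `Ψ`, under the cofactor matrix of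
the derivative of `Ψ`. The cofactor matrix is written `det (DΨ) (DΨ)⁻¹`, so that the field is zero
where `DΨ` is not invertible. -/
noncomputable def cofactorField (Ψ : E → E) (A : E →L[ℝ] E) (x : E) : E :=
  (fderiv ℝ Ψ x).det • Ring.inverse (fderiv ℝ Ψ x) (A (Ψ x))

protected theorem IsPosHomogeneous.cofactorField {Ψ : E → E} (hΨ : IsPosHomogeneous Ψ 1)
    (A : E →L[ℝ] E) :
    IsPosHomogeneous (cofactorField Ψ A) 1 := by
  have hDΨ : IsPosHomogeneous (fderiv ℝ Ψ) 0 := by simpa using hΨ.fderiv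
  refine isPosHomogeneous_one_iff.2 fun t ht x hx => ?_
  simp only [ConvexBodyGeometry.cofactorField, isPosHomogeneous_zero_iff.1 hDΨ ht hx,
    isPosHomogeneous_one_iff.1 hΨ ht hx, map_smul, smul_comm _ t]

theorem trace_ringInverse_mul_mul (A : E →L[ℝ] E) {M : E →L[ℝ] E} (hM : IsUnit M) :
    LinearMap.trace ℝ E (Ring.inverse M * A * M : E →L[ℝ] E) = LinearMap.trace ℝ E A := by
  calc LinearMap.trace ℝ E (Ring.inverse M * A * M : E →L[ℝ] E)
      = LinearMap.trace ℝ E (M * (Ring.inverse M * A) : E →L[ℝ] E) :=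
        LinearMap.trace_mul_comm ℝ (Ring.inverse M * A : E →L[ℝ] E).toLinearMap M.toLinearMap
    _ = LinearMap.trace ℝ E A := by rw [Ring.mul_inverse_cancel_left _ _ hM]

variable [FiniteDimensional ℝ E]

theorem contDiff_det {n : ℕ∞ω} : ContDiff ℝ n fun A : E →L[ℝ] E => A.det := by
  let b := finBasis ℝ E
  have hdet (A : E →L[ℝ] E) : A.det = ∑ σ : Equiv.Perm (Fin (finrank ℝ E)),
      (Equiv.Perm.sign σ : ℝ) * ∏ i, b.coord (σ i) (A (b i)) := by
    rw [ContinuousLinearMap.det, ← LinearMap.det_toMatrix b, Matrix.det_apply']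
    simp [LinearMap.toMatrix_apply]
  simp_rw [hdet]
  refine ContDiff.sum fun σ _ => contDiff_const.mul (contDiff_prod fun i _ => ?_)
  exact ((b.coord (σ i)).toContinuousLinearMap.comp (ContinuousLinearMap.apply ℝ E (b i))).contDiff

theorem hasDerivAt_det_one_add_smul (N : E →L[ℝ] E) :
    HasDerivAt (fun t : ℝ => (1 + t • N).det) (LinearMap.trace ℝ E N) 0 := by
  let b := finBasis ℝ E
  let P := LinearMap.toMatrix b b (N : E →ₗ[ℝ] E)
  let detPoly : Polynomial ℝ := (1 + (Polynomial.X : Polynomial ℝ) • P.map Polynomial.C).det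
  have hdet (t : ℝ) : (1 + t • N).det = detPoly.eval t := by
    rw [ContinuousLinearMap.det, ← LinearMap.det_toMatrix b, ← Polynomial.coe_evalRingHom,
      RingHom.map_det]
    congr 1
    ext i j
    simp [P, LinearMap.toMatrix_one, Matrix.one_apply, apply_ite, mul_comm t]
  rw [LinearMap.trace_eq_matrix_trace ℝ b, ← Matrix.derivative_det_one_add_X_smul]
  simpa only [hdet] using detPoly.hasDerivAt 0

theorem fderiv_det_apply {M : E →L[ℝ] E} (hM : IsUnit M) (H : E →L[ℝ] E) :
    fderiv ℝ ContinuousLinearMap.det M H =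
      M.det * LinearMap.trace ℝ E (Ring.inverse M * H : E →L[ℝ] E) := by
  have hdet : HasFDerivAt ContinuousLinearMap.det (fderiv ℝ ContinuousLinearMap.det M)
      (M + (0 : ℝ) • H) := by
    rw [zero_smul, add_zero]
    exact (contDiff_det.differentiable one_ne_zero M).hasFDerivAt
  have hline : HasDerivAt (fun t : ℝ => M + t • H) H 0 := by
    simpa using ((hasDerivAt_id (0 : ℝ)).smul_const H).const_add M
  refine (hdet.comp_hasDerivAt (0 : ℝ) hline).unique
    (((hasDerivAt_det_one_add_smul (Ring.inverse M * H)).const_mul M.det).congr_of_eventuallyEq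
      (.of_forall fun t => ?_))
  have hfactor : M + t • H = M * (1 + t • (Ring.inverse M * H)) := by
    rw [mul_add, mul_one, mul_smul_comm, Ring.mul_inverse_cancel_left _ _ hM]
  exact (congrArg ContinuousLinearMap.det hfactor).trans (LinearMap.det_comp _ _)

variable {Ψ : E → E} (A : E →L[ℝ] E) {x : E}

theorem contDiffAt_cofactorField {n : ℕ∞ω} (hΨ : ContDiffAt ℝ (n + 1) Ψ x)
    (hM : IsUnit (fderiv ℝ Ψ x)) : ContDiffAt ℝ n (cofactorField Ψ A) x := by
  have hDΨ : ContDiffAt ℝ n (fderiv ℝ Ψ) x := hΨ.fderiv_right le_rfl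
  obtain ⟨u, hu⟩ := hM
  have hinv : ContDiffAt ℝ n Ring.inverse (fderiv ℝ Ψ x) := hu ▸ contDiffAt_ringInverse ℝ u
  exact (contDiff_det.contDiffAt.comp x hDΨ).smul ((hinv.comp x hDΨ).clm_apply
    (A.contDiff.contDiffAt.comp x (hΨ.of_le le_self_add)))

/-- The **Piola identity**: the two second derivatives of `Ψ`, one from Jacobi's formula and one
from differentiating the inverse, cancel by symmetry. -/
theorem divergence_cofactorField (hΨ : ContDiffAt ℝ 2 Ψ x) (hM : IsUnit (fderiv ℝ Ψ x)) :
    divergence (cofactorField Ψ A) x = (fderiv ℝ Ψ x).det * LinearMap.trace ℝ E A := by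
  set M := fderiv ℝ Ψ x
  set z := Ring.inverse M (A (Ψ x))
  have hΨ' : HasFDerivAt Ψ M x := (hΨ.differentiableAt two_ne_zero).hasFDerivAt
  have hDΨ : HasFDerivAt (fderiv ℝ Ψ) (fderiv ℝ (fderiv ℝ Ψ) x) x :=
    ((hΨ.fderiv_right (m := 1) one_add_one_eq_two.le).differentiableAt one_ne_zero).hasFDerivAt
  have hdet : HasFDerivAt (fun y => (fderiv ℝ Ψ y).det)
      ((fderiv ℝ ContinuousLinearMap.det M).comp (fderiv ℝ (fderiv ℝ Ψ) x)) x :=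
    (contDiff_det.differentiable one_ne_zero M).hasFDerivAt.comp x hDΨ
  have hsolve : HasFDerivAt (fun y => Ring.inverse (fderiv ℝ Ψ y) (A (Ψ y)))
      (Ring.inverse M * A * M - Ring.inverse M * fderiv ℝ (fderiv ℝ Ψ) x z) x := by
    refine (hasFDerivAt_ringInverse_clm_apply hDΨ (A.hasFDerivAt.comp x hΨ') hM).congr_fderiv ?_
    ext v
    have hsymm := hΨ.isSymmSndFDerivAt (by simp) v z
    simp [M, z, hsymm]
  calc divergence (cofactorField Ψ A) x
      = M.det * divergence (fun y => Ring.inverse (fderiv ℝ Ψ y) (A (Ψ y))) x +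
          fderiv ℝ (fun y => (fderiv ℝ Ψ y).det) x z :=
        divergence_smul hdet.differentiableAt hsolve.differentiableAt
    _ = M.det * (LinearMap.trace ℝ E A -
          LinearMap.trace ℝ E (Ring.inverse M * fderiv ℝ (fderiv ℝ Ψ) x z : E →L[ℝ] E)) +
          M.det * LinearMap.trace ℝ E (Ring.inverse M * fderiv ℝ (fderiv ℝ Ψ) x z : E →L[ℝ] E) := by
        rw [divergence, hsolve.fderiv, ContinuousLinearMap.toLinearMap_sub, map_sub,
          trace_ringInverse_mul_mul A hM, hdet.fderiv, ContinuousLinearMap.comp_apply,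
          fderiv_det_apply hM]
    _ = M.det * LinearMap.trace ℝ E A := by ring

end Piola

section SphereHessian

theorem fderiv_fderiv_mul_apply {E : Type*} [NormedAddCommGroup E] [NormedSpace ℝ E]
    {f g : E → ℝ} {x : E} (hf : ContDiffAt ℝ 2 f x) (hg : ContDiffAt ℝ 2 g x) (u v : E) :
    fderiv ℝ (fderiv ℝ fun y => f y * g y) x u v =
      f x * fderiv ℝ (fderiv ℝ g) x u v + fderiv ℝ f x u * fderiv ℝ g x v +
        (g x * fderiv ℝ (fderiv ℝ f) x u v + fderiv ℝ g x u * fderiv ℝ f x v) := by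
  have hDf : DifferentiableAt ℝ (fderiv ℝ f) x :=
    (hf.fderiv_right (m := 1) one_add_one_eq_two.le).differentiableAt one_ne_zero
  have hDg : DifferentiableAt ℝ (fderiv ℝ g) x :=
    (hg.fderiv_right (m := 1) one_add_one_eq_two.le).differentiableAt one_ne_zero
  have hf' := hf.differentiableAt two_ne_zero
  have hg' := hg.differentiableAt two_ne_zero
  have hmul : fderiv ℝ (fun y => f y * g y) =ᶠ[nhds x]
      fun y => f y • fderiv ℝ g y + g y • fderiv ℝ f y := by
    filter_upwards [hf.eventually (by simp), hg.eventually (by simp)] with y hfy hgy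
    exact fderiv_fun_mul (hfy.differentiableAt two_ne_zero) (hgy.differentiableAt two_ne_zero)
  rw [hmul.fderiv_eq, fderiv_fun_add (hf'.fun_smul hDg) (hg'.fun_smul hDf),
    fderiv_fun_smul hf' hDg, fderiv_fun_smul hg' hDf]
  simp only [add_apply, smul_apply, ContinuousLinearMap.smulRight_apply, smul_eq_mul]

variable {E : Type*} [NormedAddCommGroup E] [InnerProductSpace ℝ E]

theorem fderiv_norm_apply {x : E} (hx : x ≠ 0) (v : E) :
    fderiv ℝ (fun y : E => ‖y‖) x v = ‖x‖⁻¹ * ⟪x, v⟫_ℝ := by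
  rw [(hasFDerivAt_norm hx).fderiv]
  rfl

theorem fderiv_fderiv_norm_apply {x : E} (hx : x ≠ 0) (u v : E) :
    ‖x‖ * fderiv ℝ (fderiv ℝ fun y : E => ‖y‖) x u v =
      ⟪u, v⟫_ℝ - ‖x‖⁻¹ * ⟪x, u⟫_ℝ * (‖x‖⁻¹ * ⟪x, v⟫_ℝ) := by
  have hnorm : ContDiffAt ℝ 2 (fun y : E => ‖y‖) x := contDiffAt_norm ℝ hx
  let bilin : E →L[ℝ] E →L[ℝ] ℝ := innerSL ℝ
  have hsq : fderiv ℝ (fun y : E => ‖y‖ * ‖y‖) = ⇑((2 : ℕ) • bilin) := by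
    simp_rw [← pow_two, fderiv_norm_sq]
    rfl
  have hmul := fderiv_fderiv_mul_apply hnorm hnorm u v
  rw [hsq, ContinuousLinearMap.fderiv, fderiv_norm_apply hx, fderiv_norm_apply hx] at hmul
  have hbilin : bilin u v = ⟪u, v⟫_ℝ := rfl
  simp only [smul_apply, hbilin, nsmul_eq_mul, Nat.cast_ofNat] at hmul
  linarith

variable {h : E → ℝ} {x : E}

theorem contDiffAt_radialExtension {n : ℕ∞ω} (hh : ContDiffOn ℝ n h {0}ᶜ) (hx : x ≠ 0) :
    ContDiffAt ℝ n (radialExtension h) x := by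
  have hx' : ‖x‖⁻¹ • x ≠ 0 := smul_ne_zero (inv_ne_zero (norm_ne_zero_iff.2 hx)) hx
  have hdir : ContDiffAt ℝ n (fun y : E => ‖y‖⁻¹ • y) x :=
    ((contDiffAt_norm ℝ hx).inv (norm_ne_zero_iff.2 hx)).smul contDiffAt_id
  exact ContDiffAt.comp (f := fun y : E => ‖y‖⁻¹ • y) x
    (hh.contDiffAt (isOpen_compl_singleton.mem_nhds hx')) hdir

theorem IsPosHomogeneous.norm_mul_radialExtension (hhom : IsPosHomogeneous h 1) (hx : x ≠ 0) :
    ‖x‖ * radialExtension h x = h x := by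
  have hnorm : 0 < ‖x‖ := norm_pos_iff.2 hx
  rw [radialExtension, ← smul_eq_mul,
    ← isPosHomogeneous_one_iff.1 hhom hnorm (smul_ne_zero (inv_ne_zero hnorm.ne') hx),
    smul_inv_smul₀ hnorm.ne']

theorem fderiv_fderiv_apply_tangent (hh : ContDiffOn ℝ 2 h {0}ᶜ) (hhom : IsPosHomogeneous h 1)
    (hx : ‖x‖ = 1) (u v : tangent x) :
    fderiv ℝ (fderiv ℝ h) x (u : E) (v : E) = sphereHessian h x u v + h x * ⟪u, v⟫_ℝ := by
  have hx0 : x ≠ 0 := norm_ne_zero_iff.1 (by simp [hx])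
  have hu : ⟪x, (u : E)⟫_ℝ = 0 := Submodule.mem_orthogonal_singleton_iff_inner_right.1 u.2
  have hv : ⟪x, (v : E)⟫_ℝ = 0 := Submodule.mem_orthogonal_singleton_iff_inner_right.1 v.2
  have hpolar : h =ᶠ[nhds x] fun y => ‖y‖ * radialExtension h y := by
    filter_upwards [isOpen_compl_singleton.mem_nhds hx0] with y hy
      using (hhom.norm_mul_radialExtension hy).symm
  have hradial : radialExtension h x = h x := by simp [radialExtension, hx]
  have hnorm := fderiv_fderiv_norm_apply hx0 (u : E) (v : E)
  rw [hx, hu, hv, one_mul, mul_zero, zero_mul, sub_zero] at hnorm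
  rw [hpolar.fderiv.fderiv_eq, fderiv_fderiv_mul_apply (contDiffAt_norm ℝ hx0)
    (contDiffAt_radialExtension hh hx0), fderiv_norm_apply hx0, fderiv_norm_apply hx0, hu, hv,
    hnorm, hx, hradial, sphereHessian, Submodule.coe_inner]
  ring

end SphereHessian

section NormalMap

variable {E : Type*} [NormedAddCommGroup E] [InnerProductSpace ℝ E] [CompleteSpace E]

/-- The map sending an outward unit normal to the boundary point of the body with support function
`h` which has this normal, extended to be positively homogeneous of degree one. -/
noncomputable def normalMap (h : E → ℝ) (x : E) : E :=
  ‖x‖ • gradient h x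

variable {h : E → ℝ} {x : E}

protected theorem IsPosHomogeneous.normalMap (hhom : IsPosHomogeneous h 1) :
    IsPosHomogeneous (normalMap h) 1 := by
  have hgrad : IsPosHomogeneous (gradient h) (1 - 1) :=
    hhom.fderiv.map (InnerProductSpace.toDual ℝ E).symm
  have hprod : IsPosHomogeneous (normalMap h) (1 + (1 - 1)) := isPosHomogeneous_norm.smul hgrad
  rwa [sub_self, add_zero] at hprod

theorem contDiffAt_gradient {n : ℕ∞ω} (hh : ContDiffAt ℝ (n + 1) h x) :
    ContDiffAt ℝ n (gradient h) x :=
  (InnerProductSpace.toDual ℝ E).symm.contDiff.contDiffAt.comp x (hh.fderiv_right le_rfl)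

theorem contDiffAt_normalMap {n : ℕ∞ω} (hh : ContDiffAt ℝ (n + 1) h x) (hx : x ≠ 0) :
    ContDiffAt ℝ n (normalMap h) x :=
  (contDiffAt_norm ℝ hx).smul (contDiffAt_gradient hh)

theorem inner_fderiv_gradient (hh : ContDiffAt ℝ 2 h x) (v w : E) :
    ⟪fderiv ℝ (gradient h) x v, w⟫_ℝ = fderiv ℝ (fderiv ℝ h) x v w := by
  have hDh : DifferentiableAt ℝ (fderiv ℝ h) x :=
    (hh.fderiv_right (m := 1) one_add_one_eq_two.le).differentiableAt one_ne_zero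
  have hgrad : HasFDerivAt (gradient h) _ x :=
    (InnerProductSpace.toDual ℝ E).symm.toContinuousLinearEquiv.hasFDerivAt.comp x hDh.hasFDerivAt
  rw [hgrad.fderiv]
  exact InnerProductSpace.toDual_symm_apply

theorem inner_fderiv_normalMap (hh : ContDiffAt ℝ 2 h x) (hx : x ≠ 0) (v w : E) :
    ⟪fderiv ℝ (normalMap h) x v, w⟫_ℝ =
      ‖x‖ * fderiv ℝ (fderiv ℝ h) x v w + ‖x‖⁻¹ * ⟪x, v⟫_ℝ * fderiv ℝ h x w := by
  have hgrad : DifferentiableAt ℝ (gradient h) x :=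
    (contDiffAt_gradient (n := 1) (by rwa [one_add_one_eq_two])).differentiableAt one_ne_zero
  have hprod : HasFDerivAt (normalMap h) _ x := (hasFDerivAt_norm hx).fun_smul hgrad.hasFDerivAt
  rw [hprod.fderiv]
  simp [inner_add_left, inner_smul_left, inner_gradient_left, inner_fderiv_gradient hh]

theorem inner_self_fderiv_normalMap (hh : ContDiffAt ℝ 2 h x) (hhom : IsPosHomogeneous h 1)
    (hx : x ≠ 0) (v : E) :
    ⟪x, fderiv ℝ (normalMap h) x v⟫_ℝ = ‖x‖⁻¹ * h x * ⟪x, v⟫_ℝ := by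
  have hEuler : fderiv ℝ h x x = h x := by
    simpa using hhom.fderiv_apply_self hx (hh.differentiableAt two_ne_zero)
  have hEuler' : fderiv ℝ (fderiv ℝ h) x x = 0 := by
    simpa using hhom.fderiv.fderiv_apply_self hx
      ((hh.fderiv_right (m := 1) one_add_one_eq_two.le).differentiableAt one_ne_zero)
  rw [real_inner_comm, inner_fderiv_normalMap hh hx, hh.isSymmSndFDerivAt (by simp), hEuler',
    hEuler, zero_apply, mul_zero, zero_add, mul_right_comm]

end NormalMap

section Determinant

variable {E : Type*} [NormedAddCommGroup E] [InnerProductSpace ℝ E]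

theorem det_restrict_eq_det_inner {S : Submodule ℝ E} {M : E →ₗ[ℝ] E} (hM : ∀ v ∈ S, M v ∈ S)
    {ι : Type*} [Fintype ι] [DecidableEq ι] (b : OrthonormalBasis ι ℝ S) :
    (M.restrict hM).det = (Matrix.of fun i j => ⟪M (b i), (b j : E)⟫_ℝ).det := by
  rw [← LinearMap.det_toMatrix b.toBasis, ← Matrix.det_transpose]
  congr 1
  ext i j
  rw [Matrix.transpose_apply, LinearMap.toMatrix_apply, OrthonormalBasis.coe_toBasis_repr_apply,
    OrthonormalBasis.coe_toBasis, OrthonormalBasis.repr_apply_apply, real_inner_comm]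
  rfl

variable [FiniteDimensional ℝ E]

theorem finrank_quotient_tangent {x : E} (hx : x ≠ 0) : finrank ℝ (E ⧸ tangent x) = 1 := by
  have hquot := Submodule.finrank_quotient_add_finrank (tangent x)
  have hsum : finrank ℝ (ℝ ∙ x) + finrank ℝ (tangent x) = finrank ℝ E :=
    Submodule.finrank_add_finrank_orthogonal (ℝ ∙ x)
  rw [finrank_span_singleton hx] at hsum
  omega

/-- The operator preserves `x^⊥`, and acts on the line `E ⧸ x^⊥` as multiplication by `c`. -/
theorem det_eq_mul_det_inner {M : E →ₗ[ℝ] E} {x : E} (hx : x ≠ 0) {c : ℝ}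
    (hM : ∀ v, ⟪x, M v⟫_ℝ = c * ⟪x, v⟫_ℝ) {ι : Type*} [Fintype ι] [DecidableEq ι]
    (b : OrthonormalBasis ι ℝ (tangent x)) :
    M.det = c * (Matrix.of fun i j => ⟪M (b i), (b j : E)⟫_ℝ).det := by
  have hT : ∀ v ∈ tangent x, M v ∈ tangent x := fun v hv => by
    rw [Submodule.mem_orthogonal_singleton_iff_inner_right] at hv ⊢
    rw [hM, hv, mul_zero]
  have hquot : (tangent x).mapQ (tangent x) M hT = c • LinearMap.id := by
    ext v
    simp only [LinearMap.comp_apply, Submodule.mkQ_apply, Submodule.mapQ_apply,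
      LinearMap.smul_apply, LinearMap.id_apply]
    rw [← Submodule.Quotient.mk_smul, Submodule.Quotient.eq,
      Submodule.mem_orthogonal_singleton_iff_inner_right, inner_sub_right, inner_smul_right, hM,
      sub_self]
  rw [LinearMap.det_eq_det_mul_det (tangent x) M hT, hquot, LinearMap.det_smul,
    finrank_quotient_tangent hx, pow_one, LinearMap.det_id, mul_one, mul_comm,
    det_restrict_eq_det_inner hT b]

end Determinant

section SphereIdentities

theorem continuous_comp_sphere_coe {E X : Type*} [NormedAddCommGroup E] [TopologicalSpace X]
    {f : E → X} (hf : ContinuousOn f {0}ᶜ) :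
    Continuous fun x : Metric.sphere (0 : E) 1 => f x :=
  hf.comp_continuous continuous_subtype_val fun x =>
    norm_ne_zero_iff.1 (by simp [norm_eq_of_mem_sphere x])

variable {E : Type*} [NormedAddCommGroup E] [InnerProductSpace ℝ E] [FiniteDimensional ℝ E]
  [MeasurableSpace E] [BorelSpace E]

theorem integrable_sphere_of_continuous {F : Type*} [NormedAddCommGroup F]
    {ν : Measure (Metric.sphere (0 : E) 1)} [IsFiniteMeasure ν] {f : Metric.sphere (0 : E) 1 → F}
    (hf : Continuous f) : Integrable f ν :=
  hf.integrable_of_hasCompactSupport (.of_compactSpace _)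

variable [Nontrivial E] (μ : Measure E) [μ.IsAddHaarMeasure]

theorem integral_sphere_inner_cofactorField {Ψ : E → E} (hΨ : ContDiffOn ℝ 2 Ψ {0}ᶜ)
    (hhom : IsPosHomogeneous Ψ 1) (hunit : ∀ x, x ≠ 0 → IsUnit (fderiv ℝ Ψ x)) (A : E →L[ℝ] E) :
    finrank ℝ E * ∫ x : Metric.sphere (0 : E) 1, ⟪(x : E), cofactorField Ψ A x⟫_ℝ ∂μ.toSphere =
      LinearMap.trace ℝ E A *
        ∫ x : Metric.sphere (0 : E) 1, (fderiv ℝ Ψ x).det ∂μ.toSphere := by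
  have hΨ' (x : E) (hx : x ≠ 0) : ContDiffAt ℝ 2 Ψ x :=
    hΨ.contDiffAt (isOpen_compl_singleton.mem_nhds hx)
  have hcof : ContDiffOn ℝ 1 (cofactorField Ψ A) {0}ᶜ := fun x hx =>
    (contDiffAt_cofactorField A (by rw [one_add_one_eq_two]; exact hΨ' x hx)
      (hunit x hx)).contDiffWithinAt
  have hdiv := integral_sphere_divergence μ hcof (hhom.cofactorField A)
  rw [sub_add_cancel] at hdiv
  rw [← hdiv, ← integral_const_mul]
  refine integral_congr_ae (.of_forall fun x => ?_)
  have hx := ne_zero_of_mem_unit_sphere x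
  exact (divergence_cofactorField A (hΨ' x hx) (hunit x hx)).trans (mul_comm _ _)

theorem integral_sphere_rpow_mul_inner {h : E → ℝ} (hh : ContDiffOn ℝ 1 h {0}ᶜ)
    (hhom : IsPosHomogeneous h 1) (hpos : ∀ x, x ≠ 0 → 0 < h x) (p : ℝ) (B : E →L[ℝ] E) :
    (finrank ℝ E + p) * ∫ x : Metric.sphere (0 : E) 1, h x ^ p * ⟪(x : E), B x⟫_ℝ ∂μ.toSphere =
      p * ∫ x : Metric.sphere (0 : E) 1, h x ^ (p - 1) * fderiv ℝ h x (B x) ∂μ.toSphere +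
        LinearMap.trace ℝ E B * ∫ x : Metric.sphere (0 : E) 1, h x ^ p ∂μ.toSphere := by
  have hW : ContDiffOn ℝ 1 (fun x => h x ^ p • B x) {0}ᶜ :=
    (hh.rpow_const_of_ne fun x hx => (hpos x hx).ne').smul B.contDiff.contDiffOn
  have hWhom : IsPosHomogeneous (fun x => h x ^ p • B x) (1 * p + 1) :=
    (hhom.rpow (fun x hx => (hpos x hx).le) p).smul (isPosHomogeneous_id.map B)
  have hdiv (x : Metric.sphere (0 : E) 1) : divergence (fun y => h y ^ p • B y) x =
      p * (h x ^ (p - 1) * fderiv ℝ h x (B x)) + LinearMap.trace ℝ E B * h x ^ p := by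
    have hx := ne_zero_of_mem_unit_sphere x
    have hrpow := ((hh.differentiableOn one_ne_zero).differentiableAt
      (isOpen_compl_singleton.mem_nhds hx)).hasFDerivAt.rpow_const (p := p) (Or.inl (hpos x hx).ne')
    rw [divergence_smul hrpow.differentiableAt B.differentiableAt, divergence_clm, hrpow.fderiv,
      smul_apply, smul_eq_mul]
    ring
  have hrpow_cont (q : ℝ) : Continuous fun x : Metric.sphere (0 : E) 1 => h x ^ q :=
    continuous_comp_sphere_coe
      (hh.continuousOn.rpow_const fun x hx => Or.inl (hpos x hx).ne')
  have hfderiv_cont : Continuous fun x : Metric.sphere (0 : E) 1 => fderiv ℝ h x (B x) :=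
    continuous_comp_sphere_coe
      ((hh.continuousOn_fderiv_of_isOpen isOpen_compl_singleton le_rfl).clm_apply
        B.continuous.continuousOn)
  have hident := integral_sphere_divergence μ hW hWhom
  simp_rw [hdiv, real_inner_smul_right] at hident
  rw [integral_add (integrable_sphere_of_continuous (by fun_prop))
    (integrable_sphere_of_continuous (by fun_prop)), integral_const_mul,
    integral_const_mul] at hident
  linear_combination -hident

end SphereIdentities

section SupportFunction

variable {E : Type*} [NormedAddCommGroup E] [InnerProductSpace ℝ E] {K : Set E}

theorem isPosHomogeneous_supportFunction (K : Set E) : IsPosHomogeneous (supportFunction K) 1 := by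
  refine isPosHomogeneous_one_iff.2 fun t ht x _ => ?_
  rw [supportFunction, supportFunction, ← Real.sSup_smul_of_nonneg ht.le, ← Set.image_smul,
    Set.image_image]
  simp only [real_inner_smul_left, smul_eq_mul]

theorem supportFunction_pos (hK : Bornology.IsBounded K) (h0 : (0 : E) ∈ interior K) {x : E}
    (hx : x ≠ 0) : 0 < supportFunction K x := by
  have hray : ∀ᶠ t : ℝ in nhdsWithin 0 (Ioi 0), t • x ∈ K := by
    have hlim : Filter.Tendsto (fun t : ℝ => t • x) (nhdsWithin 0 (Ioi 0)) (nhds 0) :=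
      ((continuous_id.smul continuous_const).tendsto' (0 : ℝ) (0 : E) (zero_smul ℝ x)).mono_left
        nhdsWithin_le_nhds
    exact hlim.eventually (mem_interior_iff_mem_nhds.1 h0)
  obtain ⟨t, htK, ht : 0 < t⟩ := (hray.and self_mem_nhdsWithin).exists
  have hbdd : BddAbove ((fun y => ⟪x, y⟫_ℝ) '' K) :=
    ((innerSL ℝ x).lipschitz.isBounded_image hK).bddAbove
  calc 0 < t * ⟪x, x⟫_ℝ := mul_pos ht (real_inner_self_pos.2 hx)
    _ = ⟪x, t • x⟫_ℝ := (real_inner_smul_right _ _ _).symm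
    _ ≤ supportFunction K x := le_csSup hbdd ⟨_, htK, rfl⟩

theorem curvatureForm_eq_inner_fderiv_normalMap [CompleteSpace E]
    (hh : ContDiffOn ℝ 2 (supportFunction K) {0}ᶜ) {x : E} (hx : ‖x‖ = 1) (u v : tangent x) :
    curvatureForm K x u v = ⟪fderiv ℝ (normalMap (supportFunction K)) x u, (v : E)⟫_ℝ := by
  have hx0 : x ≠ 0 := norm_ne_zero_iff.1 (by simp [hx])
  rw [curvatureForm, ← fderiv_fderiv_apply_tangent hh (isPosHomogeneous_supportFunction K) hx,
    inner_fderiv_normalMap (hh.contDiffAt (isOpen_compl_singleton.mem_nhds hx0)) hx0, hx,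
    Submodule.mem_orthogonal_singleton_iff_inner_right.1 u.2]
  ring

theorem inner_self_fderiv_normalMap_supportFunction [CompleteSpace E]
    (hh : ContDiffOn ℝ 2 (supportFunction K) {0}ᶜ) {x : E} (hx : ‖x‖ = 1) (v : E) :
    ⟪x, fderiv ℝ (normalMap (supportFunction K)) x v⟫_ℝ = supportFunction K x * ⟪x, v⟫_ℝ := by
  have hx0 : x ≠ 0 := norm_ne_zero_iff.1 (by simp [hx])
  rw [inner_self_fderiv_normalMap (hh.contDiffAt (isOpen_compl_singleton.mem_nhds hx0))
    (isPosHomogeneous_supportFunction K) hx0, hx, inv_one, one_mul]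

theorem det_fderiv_normalMap_supportFunction [FiniteDimensional ℝ E]
    (hh : ContDiffOn ℝ 2 (supportFunction K) {0}ᶜ) {x : E} (hx : ‖x‖ = 1) :
    (fderiv ℝ (normalMap (supportFunction K)) x).det =
      supportFunction K x / gaussCurvature K x := by
  have hx0 : x ≠ 0 := norm_ne_zero_iff.1 (by simp [hx])
  rw [ContinuousLinearMap.det, det_eq_mul_det_inner hx0
    (inner_self_fderiv_normalMap_supportFunction hh hx) (stdOrthonormalBasis ℝ (tangent x))]
  simp [gaussCurvature, curvatureForm_eq_inner_fderiv_normalMap hh hx]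

end SupportFunction

section Isotropy

variable {E : Type*} [NormedAddCommGroup E] [InnerProductSpace ℝ E] [FiniteDimensional ℝ E]

theorem trace_adjoint (B : E →L[ℝ] E) :
    LinearMap.trace ℝ E (ContinuousLinearMap.adjoint B : E →L[ℝ] E) = LinearMap.trace ℝ E B := by
  simp [LinearMap.trace_eq_sum_inner _ (stdOrthonormalBasis ℝ E),
    ContinuousLinearMap.adjoint_inner_right, real_inner_comm]

theorem integral_rankOne_self_eq_smul_id {X : Type*} [MeasurableSpace X] {ν : Measure X}
    {g : X → E} (hg : Integrable (fun x => InnerProductSpace.rankOne ℝ (g x) (g x)) ν) {c : ℝ}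
    (hc : ∀ B : E →L[ℝ] E, ∫ x, ⟪g x, B (g x)⟫_ℝ ∂ν = c * LinearMap.trace ℝ E B) :
    ∫ x, InnerProductSpace.rankOne ℝ (g x) (g x) ∂ν = c • ContinuousLinearMap.id ℝ E := by
  ext1 w
  refine ext_inner_left ℝ fun z => ?_
  have hw : Integrable (fun x => InnerProductSpace.rankOne ℝ (g x) (g x) w) ν :=
    hg.apply_continuousLinearMap w
  calc ⟪z, (∫ x, InnerProductSpace.rankOne ℝ (g x) (g x) ∂ν) w⟫_ℝ
      = ∫ x, ⟪z, InnerProductSpace.rankOne ℝ (g x) (g x) w⟫_ℝ ∂ν := by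
        rw [ContinuousLinearMap.integral_apply hg, integral_inner hw]
    _ = ∫ x, ⟪g x, InnerProductSpace.rankOne ℝ w z (g x)⟫_ℝ ∂ν := by
        simp only [InnerProductSpace.rankOne_apply, real_inner_smul_right, real_inner_comm,
          mul_comm]
    _ = ⟪z, (c • ContinuousLinearMap.id ℝ E) w⟫_ℝ := by
        rw [hc, InnerProductSpace.trace_rankOne, smul_apply,
          ContinuousLinearMap.id_apply, real_inner_smul_right]

instance [MeasurableSpace E] [BorelSpace E] : IsFiniteMeasure (sphereMeasure E) :=
  inferInstanceAs (IsFiniteMeasure (volume : Measure E).toSphere)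

end Isotropy

section ConvexBody

variable {E : Type*} [NormedAddCommGroup E] [InnerProductSpace ℝ E] {K : Set E}

namespace IsSmoothStrictlyConvexBody

theorem contDiffOn_two (hK : IsSmoothStrictlyConvexBody K) :
    ContDiffOn ℝ 2 (supportFunction K) {0}ᶜ :=
  contDiffOn_infty.1 hK.smooth 2

theorem continuous_supportFunction_rpow (hK : IsSmoothStrictlyConvexBody K)
    (h0 : (0 : E) ∈ interior K) (q : ℝ) :
    Continuous fun x : Metric.sphere (0 : E) 1 => supportFunction K x ^ q :=
  continuous_comp_sphere_coe (hK.smooth.continuousOn.rpow_const fun _ hx =>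
    Or.inl (supportFunction_pos hK.isCompact.isBounded h0 hx).ne')

variable [FiniteDimensional ℝ E]

theorem contDiffOn_normalMap (hK : IsSmoothStrictlyConvexBody K) :
    ContDiffOn ℝ 2 (normalMap (supportFunction K)) {0}ᶜ := fun _ hx =>
  (contDiffAt_normalMap ((contDiffOn_infty.1 hK.smooth 3).contDiffAt
    (isOpen_compl_singleton.mem_nhds hx)) hx).contDiffWithinAt

theorem injective_fderiv_normalMap (hK : IsSmoothStrictlyConvexBody K)
    (h0 : (0 : E) ∈ interior K) {x : E} (hx : ‖x‖ = 1) :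
    Function.Injective (fderiv ℝ (normalMap (supportFunction K)) x) := by
  rw [injective_iff_map_eq_zero]
  intro v hv
  have hpos := supportFunction_pos hK.isCompact.isBounded h0 (norm_ne_zero_iff.1 (hx ▸ one_ne_zero))
  have hradial : supportFunction K x * ⟪x, v⟫_ℝ = 0 := by
    rw [← inner_self_fderiv_normalMap_supportFunction hK.contDiffOn_two hx, hv, inner_zero_right]
  have hv_tangent : v ∈ tangent x := Submodule.mem_orthogonal_singleton_iff_inner_right.2
    ((mul_eq_zero.1 hradial).resolve_left hpos.ne')
  by_contra hne
  have hcurv := hK.posDef x hx ⟨v, hv_tangent⟩ (by simpa [Subtype.ext_iff] using hne)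
  simp [curvatureForm_eq_inner_fderiv_normalMap hK.contDiffOn_two hx, hv] at hcurv

theorem isUnit_fderiv_normalMap (hK : IsSmoothStrictlyConvexBody K)
    (h0 : (0 : E) ∈ interior K) {x : E} (hx : x ≠ 0) :
    IsUnit (fderiv ℝ (normalMap (supportFunction K)) x) := by
  have hhom : IsPosHomogeneous (fderiv ℝ (normalMap (supportFunction K))) 0 :=
    sub_self (1 : ℝ) ▸ (isPosHomogeneous_supportFunction K).normalMap.fderiv
  rw [← isPosHomogeneous_zero_iff.1 hhom (inv_pos.2 (norm_pos_iff.2 hx)) hx,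
    ContinuousLinearMap.isUnit_iff_bijective]
  have hinj := hK.injective_fderiv_normalMap h0 (norm_smul_inv_norm (𝕜 := ℝ) hx)
  exact ⟨hinj, LinearMap.surjective_of_injective hinj⟩

theorem inner_cofactorField_normalMap (hK : IsSmoothStrictlyConvexBody K)
    (h0 : (0 : E) ∈ interior K) (A : E →L[ℝ] E) {x : E} (hx : ‖x‖ = 1) :
    ⟪x, cofactorField (normalMap (supportFunction K)) A x⟫_ℝ =
      (gaussCurvature K x)⁻¹ * ⟪x, A (gradient (supportFunction K) x)⟫_ℝ := by
  have hx0 : x ≠ 0 := norm_ne_zero_iff.1 (hx ▸ one_ne_zero)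
  set M := fderiv ℝ (normalMap (supportFunction K)) x with hM
  have hradial : supportFunction K x * ⟪x, Ring.inverse M (A (normalMap (supportFunction K) x))⟫_ℝ =
      ⟪x, A (normalMap (supportFunction K) x)⟫_ℝ := by
    rw [← inner_self_fderiv_normalMap_supportFunction hK.contDiffOn_two hx, ← hM,
      ← mul_apply_eq_comp, Ring.mul_inverse_cancel _ (hK.isUnit_fderiv_normalMap h0 hx0),
      one_apply_eq_self]
  rw [cofactorField, real_inner_smul_right,
    det_fderiv_normalMap_supportFunction hK.contDiffOn_two hx, div_mul_eq_mul_div, hradial,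
    normalMap, hx, one_smul, div_eq_inv_mul]

theorem continuous_supportFunction_div_gaussCurvature (hK : IsSmoothStrictlyConvexBody K) :
    Continuous fun x : Metric.sphere (0 : E) 1 => supportFunction K x / gaussCurvature K x := by
  have hdet := ContinuousLinearMap.continuous_det.comp (continuous_comp_sphere_coe
    (hK.contDiffOn_normalMap.continuousOn_fderiv_of_isOpen isOpen_compl_singleton one_le_two))
  exact hdet.congr fun x =>
    det_fderiv_normalMap_supportFunction hK.contDiffOn_two (norm_eq_of_mem_sphere x)

variable [MeasurableSpace E] [BorelSpace E]

theorem integral_inv_gaussCurvature_mul_inner [Nontrivial E] (hK : IsSmoothStrictlyConvexBody K)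
    (h0 : (0 : E) ∈ interior K) (A : E →L[ℝ] E) :
    finrank ℝ E * ∫ x : Metric.sphere (0 : E) 1, (gaussCurvature K x)⁻¹ *
        ⟪(x : E), A (gradient (supportFunction K) x)⟫_ℝ ∂sphereMeasure E =
      LinearMap.trace ℝ E A * ∫ x : Metric.sphere (0 : E) 1,
        supportFunction K x / gaussCurvature K x ∂sphereMeasure E := by
  have hcof := integral_sphere_inner_cofactorField volume hK.contDiffOn_normalMap
    (isPosHomogeneous_supportFunction K).normalMap (fun _ => hK.isUnit_fderiv_normalMap h0) A
  have hx (x : Metric.sphere (0 : E) 1) := norm_eq_of_mem_sphere x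
  simp_rw [hK.inner_cofactorField_normalMap h0 A (hx _),
    det_fderiv_normalMap_supportFunction hK.contDiffOn_two (hx _)] at hcof
  exact hcof

theorem isFiniteMeasure_weightedConeMeasure (hK : IsSmoothStrictlyConvexBody K) :
    IsFiniteMeasure (weightedConeMeasure K) :=
  isFiniteMeasure_withDensity_ofReal
    (integrable_sphere_of_continuous hK.continuous_supportFunction_div_gaussCurvature).2

theorem inv_gaussCurvature_ae_eq (hK : IsSmoothStrictlyConvexBody K)
    (h0 : (0 : E) ∈ interior K) {p : ℝ}
    (hV : weightedConeMeasure K = (sphereMeasure E).withDensity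
      fun x => ENNReal.ofReal (supportFunction K x ^ p)) :
    ∀ᵐ x : Metric.sphere (0 : E) 1 ∂sphereMeasure E,
      (gaussCurvature K x)⁻¹ = supportFunction K x ^ (p - 1) := by
  have hdensity := (withDensity_eq_iff_of_sigmaFinite
    hK.continuous_supportFunction_div_gaussCurvature.measurable.ennreal_ofReal.aemeasurable
    (hK.continuous_supportFunction_rpow h0 p).measurable.ennreal_ofReal.aemeasurable).1 hV
  filter_upwards [hdensity] with x hx
  have hpos := supportFunction_pos hK.isCompact.isBounded h0 (ne_zero_of_mem_unit_sphere x)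
  have hpow := Real.rpow_pos_of_pos hpos p
  have hquot : 0 < supportFunction K x / gaussCurvature K x := by
    rwa [← ENNReal.ofReal_pos, hx, ENNReal.ofReal_pos]
  rw [ENNReal.ofReal_eq_ofReal_iff hquot.le hpow.le] at hx
  rw [Real.rpow_sub_one hpos.ne', ← hx, div_right_comm, div_self hpos.ne', one_div]

theorem integral_weightedConeMeasure (hK : IsSmoothStrictlyConvexBody K)
    (h0 : (0 : E) ∈ interior K) {p : ℝ}
    (hV : weightedConeMeasure K = (sphereMeasure E).withDensity
      fun x => ENNReal.ofReal (supportFunction K x ^ p)) (f : Metric.sphere (0 : E) 1 → ℝ) :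
    ∫ x, f x ∂weightedConeMeasure K = ∫ x, supportFunction K x ^ p * f x ∂sphereMeasure E := by
  have hnonneg (x : Metric.sphere (0 : E) 1) : 0 ≤ supportFunction K x ^ p :=
    Real.rpow_nonneg
      (supportFunction_pos hK.isCompact.isBounded h0 (ne_zero_of_mem_unit_sphere x)).le p
  rw [hV, integral_withDensity_eq_integral_toReal_smul
    (hK.continuous_supportFunction_rpow h0 p).measurable.ennreal_ofReal
    (.of_forall fun _ => ENNReal.ofReal_lt_top)]
  simp only [ENNReal.toReal_ofReal (hnonneg _), smul_eq_mul]

theorem integral_inner_weightedConeMeasure [Nontrivial E] (hK : IsSmoothStrictlyConvexBody K)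
    (h0 : (0 : E) ∈ interior K) {p : ℝ} (hp : p ≠ -(finrank ℝ E : ℝ))
    (hV : weightedConeMeasure K = (sphereMeasure E).withDensity
      fun x => ENNReal.ofReal (supportFunction K x ^ p)) (B : E →L[ℝ] E) :
    ∫ x : Metric.sphere (0 : E) 1, ⟪(x : E), B x⟫_ℝ ∂weightedConeMeasure K =
      (1 / (finrank ℝ E : ℝ)) * (∫ _ : Metric.sphere (0 : E) 1, (1 : ℝ) ∂weightedConeMeasure K) *
        LinearMap.trace ℝ E B := by
  have hinv := hK.inv_gaussCurvature_ae_eq h0 hV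
  have hmoment : ∫ x : Metric.sphere (0 : E) 1, (gaussCurvature K x)⁻¹ * ⟪(x : E),
        ContinuousLinearMap.adjoint B (gradient (supportFunction K) x)⟫_ℝ ∂sphereMeasure E =
      ∫ x : Metric.sphere (0 : E) 1, supportFunction K x ^ (p - 1) *
        fderiv ℝ (supportFunction K) x (B x) ∂sphereMeasure E := by
    refine integral_congr_ae (hinv.mono fun x hx => ?_)
    dsimp only
    rw [hx, ContinuousLinearMap.adjoint_inner_right, real_inner_comm, inner_gradient_left]
  have hmass : ∫ x : Metric.sphere (0 : E) 1, supportFunction K x / gaussCurvature K x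
      ∂sphereMeasure E = ∫ x : Metric.sphere (0 : E) 1, supportFunction K x ^ p
      ∂sphereMeasure E := by
    refine integral_congr_ae (hinv.mono fun x hx => ?_)
    have hpos := supportFunction_pos hK.isCompact.isBounded h0 (ne_zero_of_mem_unit_sphere x)
    dsimp only
    rw [div_eq_mul_inv, hx, Real.rpow_sub_one hpos.ne', mul_div_cancel₀ _ hpos.ne']
  have hcurv := hK.integral_inv_gaussCurvature_mul_inner h0 (ContinuousLinearMap.adjoint B)
  rw [hmoment, hmass, trace_adjoint] at hcurv
  have hpower := integral_sphere_rpow_mul_inner (volume : Measure E)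
    (hK.contDiffOn_two.of_le one_le_two) (isPosHomogeneous_supportFunction K)
    (fun _ => supportFunction_pos hK.isCompact.isBounded h0) p B
  rw [← sphereMeasure] at hpower
  have hd : (finrank ℝ E : ℝ) ≠ 0 := Nat.cast_ne_zero.2 finrank_pos.ne'
  have hdp : (finrank ℝ E : ℝ) + p ≠ 0 := fun h => hp (by linarith)
  simp only [hK.integral_weightedConeMeasure h0 hV, mul_one]
  refine mul_left_cancel₀ hdp ?_
  rw [hpower]
  field_simp
  linear_combination p * hcurv

end IsSmoothStrictlyConvexBody

end ConvexBody

end ConvexBodyGeometry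

theorem mainTheorem5_general {E : Type*} [NormedAddCommGroup E] [InnerProductSpace ℝ E]
    [FiniteDimensional ℝ E] [Nontrivial E] [MeasurableSpace E] [BorelSpace E] {K : Set E}
    (hK : ConvexBodyGeometry.IsSmoothStrictlyConvexBody K) (h0 : (0 : E) ∈ interior K) {p : ℝ}
    (hp : p ≠ -(Module.finrank ℝ E : ℝ))
    (hV : ConvexBodyGeometry.weightedConeMeasure K =
      (ConvexBodyGeometry.sphereMeasure E).withDensity
        fun x => ENNReal.ofReal (ConvexBodyGeometry.supportFunction K x ^ p)) :
    Integrable (fun x : Metric.sphere (0 : E) 1 => InnerProductSpace.rankOne ℝ (x : E) (x : E))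
      (ConvexBodyGeometry.weightedConeMeasure K) ∧
    ∫ x : Metric.sphere (0 : E) 1, InnerProductSpace.rankOne ℝ (x : E) (x : E)
        ∂(ConvexBodyGeometry.weightedConeMeasure K) =
      ((1 / (Module.finrank ℝ E : ℝ)) * ∫ _ : Metric.sphere (0 : E) 1, (1 : ℝ)
        ∂(ConvexBodyGeometry.weightedConeMeasure K)) • ContinuousLinearMap.id ℝ E := by
  have := hK.isFiniteMeasure_weightedConeMeasure
  have hint : Integrable
      (fun x : Metric.sphere (0 : E) 1 => InnerProductSpace.rankOne ℝ (x : E) (x : E))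
      (ConvexBodyGeometry.weightedConeMeasure K) :=
    ConvexBodyGeometry.integrable_sphere_of_continuous
      (((InnerProductSpace.rankOne ℝ).continuous.comp continuous_subtype_val).clm_apply
        continuous_subtype_val)
  exact ⟨hint, ConvexBodyGeometry.integral_rankOne_self_eq_smul_id hint
    (hK.integral_inner_weightedConeMeasure h0 hp hV)⟩

theorem mainTheorem5 (n : ℕ) (K : Set (EuclideanSpace ℝ (Fin (n + 1))))
    (hK : ConvexBodyGeometry.IsSmoothStrictlyConvexBody K)
    (h0 : (0 : EuclideanSpace ℝ (Fin (n + 1))) ∈ interior K)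
    (p : ℝ) (hp : p ≠ -((n : ℝ) + 1))
    (hV : ConvexBodyGeometry.weightedConeMeasure K =
      (ConvexBodyGeometry.sphereMeasure (EuclideanSpace ℝ (Fin (n + 1)))).withDensity
        fun x => ENNReal.ofReal (ConvexBodyGeometry.supportFunction K x ^ p)) :
    Integrable (fun x : Metric.sphere (0 : EuclideanSpace ℝ (Fin (n + 1))) 1 =>
        InnerProductSpace.rankOne ℝ (x : EuclideanSpace ℝ (Fin (n + 1)))
          (x : EuclideanSpace ℝ (Fin (n + 1))))
      (ConvexBodyGeometry.weightedConeMeasure K) ∧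
    ∫ x : Metric.sphere (0 : EuclideanSpace ℝ (Fin (n + 1))) 1,
        InnerProductSpace.rankOne ℝ (x : EuclideanSpace ℝ (Fin (n + 1)))
          (x : EuclideanSpace ℝ (Fin (n + 1)))
        ∂(ConvexBodyGeometry.weightedConeMeasure K) =
      ((1 / ((n : ℝ) + 1)) *
        ∫ _ : Metric.sphere (0 : EuclideanSpace ℝ (Fin (n + 1))) 1, (1 : ℝ)
          ∂(ConvexBodyGeometry.weightedConeMeasure K)) •
        ContinuousLinearMap.id ℝ (EuclideanSpace ℝ (Fin (n + 1))) := by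
  have hdim : (Module.finrank ℝ (EuclideanSpace ℝ (Fin (n + 1))) : ℝ) = n + 1 := by simp
  rw [← hdim] at hp ⊢
  exact mainTheorem5_general hK h0 hp hV
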